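/- Diagrams are ZH-diagrams built from white spiders and H-boxes, interpreted as matrices in the computational basis; a white spider has $1$ as its all-zeros and all-ones entries and $0$ elsewhere (with no legs it is the scalar $2$), a grey spider has entry $1$ where the number of ones on its legs is even and $0$ elsewhere (it is a white spider with Hadamard H-boxes on its legs, times $1/2$), and an H-box with complex label $a$ has $a$ as its all-ones entry and $1$ elsewhere, and an exponentiated H-box with label $\alpha\in\mathbb C$ is the H-box with label $e^{i\alpha}$. Let $n\ge 0$ and $\mathbb B=\{0,1\}$. For a vector $a=(a_{\vec b})_{\vec b\in\mathbb B^n}$ of complex numbers, the ZH normal form $\mathrm{NF}(a)$ is the diagram with $n$ outputs, each ending in a white spider, in which for every $\vec b\in\mathbb B^n$ an H-box labelled $a_{\vec b}$ with $n$ legs is connected to the $n$ white spiders, its $i$-th leg passing through a NOT gate exactly when $b_i=0$. For $\alpha=(\alpha_{\vec b})_{\vec b\in\mathbb B^n}$ let $\mathrm{NF}_{\exp}(\alpha)$ be the same diagram with exponentiated H-boxes labelled $\alpha_{\vec b}$. For $\beta=(\beta_{\vec c})_{\vec c\in\mathbb B^n}$ let $\mathrm{FT}(\beta)$ be the diagram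 with $n$ outputs, each ending in a white spider, in which for every $\vec c\in\mathbb B^n$ a phase gadget (a grey spider with one leg ending in a one-legged exponentiated H-box labelled $\beta_{\vec c}$) is connected to the $i$-th white spider for exactly those $i$ with $c_i=1$. **Theorem.** Every ZH normal form can be approximated to arbitrary precision by a normal form made of exponentiated H-boxes, and hence by a Fourier transform. Precisely, let $a\in\mathbb C^{\mathbb B^n}$ and $\varepsilon>0$, and put $$\alpha_{\vec b}=\begin{cases}-i\ln a_{\vec b}&\text{if }a_{\vec b}\ne 0,\\ -i\ln\varepsilon&\text{if }a_{\vec b}=0,\end{cases}\qquad \widetilde\alpha_{\vec c}=\frac{-1}{2^{n-1}}\sum_{\vec b\in\mathbb B^n}\alpha_{\vec b}\,(-1)^{\vec b\cdot\vec c},$$ where $\ln$ is the principal branch of the complex logarithm. Then: 1. $\mathrm{NF}_{\exp}(\alpha)$ is the normal form $\mathrm{NF}(a')$, where $a'_{\vec b}=a_{\vec b}$ if $a_{\vec b}\neq 0$ and $a'_{\vec b}=\varepsilon$ if $a_{\vec b}=0$; 2. each entry of the matrix of $\mathrm{NF}_{\exp}(\alpha)$ differs from the corresponding entry of the matrix of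 $\mathrm{NF}(a)$ by at most $\varepsilon$ in absolute value; 3. $\mathrm{NF}_{\exp}(\alpha)$ equals the diagram of phase gadgets $\mathrm{FT}(\widetilde\alpha)$ up to a nonzero scalar factor, that is, the matrix of the former is a nonzero complex multiple of the matrix of the latter. -/

import Mathlib

/-- ZH-diagrams. `ZHDiagram ι κ` is the type of diagrams whose input wires are labelled by `ι` and
whose output wires are labelled by `κ` (finite types in all uses). The generators are the white
spiders and the H-boxes with a complex label; diagrams are rewired (`wires`), stacked (`comp D E`
is `D` at the bottom and `E` on top of it), placed side by side (`beside`) and replicated in an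
indexed !-box (`bang`, the side-by-side placement of a finite family). -/
inductive ZHDiagram : Type → Type → Type 1
  | zSpider (ι κ : Type) [Fintype ι] [Fintype κ] : ZHDiagram ι κ
  | hBox (ι κ : Type) [Fintype ι] [Fintype κ] (a : ℂ) : ZHDiagram ι κ
  | wires {ι κ : Type} (e : ι ≃ κ) : ZHDiagram ι κ
  | comp {ι κ μ : Type} [Fintype κ] (D : ZHDiagram ι κ) (E : ZHDiagram κ μ) : ZHDiagram ι μ
  | beside {ι κ ι' κ' : Type} (D : ZHDiagram ι κ) (E : ZHDiagram ι' κ') :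
      ZHDiagram (ι ⊕ ι') (κ ⊕ κ')
  | bang {S : Type} [Fintype S] {ι κ : S → Type} (D : (s : S) → ZHDiagram (ι s) (κ s)) :
      ZHDiagram ((s : S) × ι s) ((s : S) × κ s)

namespace ZHDiagram

open Classical in
/-- The linear map represented by a diagram, as a matrix in the computational basis: the rows are
the bit assignments of the outputs and the columns are those of the inputs. -/
noncomputable def interp : {ι κ : Type} → ZHDiagram ι κ → Matrix (κ → Bool) (ι → Bool) ℂ
  | _, _, zSpider _ _ => Matrix.of fun y x =>
      (if (∀ i, x i = false) ∧ (∀ j, y j = false) then 1 else 0) +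
        (if (∀ i, x i = true) ∧ (∀ j, y j = true) then 1 else 0)
  | _, _, hBox _ _ a => Matrix.of fun y x => if (∀ i, x i = true) ∧ (∀ j, y j = true) then a else 1
  | _, _, wires e => Matrix.of fun y x => if ∀ i, y (e i) = x i then 1 else 0
  | _, _, comp D E => interp E * interp D
  | _, _, beside D E => Matrix.of fun y x =>
      interp D (fun j => y (Sum.inl j)) (fun i => x (Sum.inl i)) *
        interp E (fun j => y (Sum.inr j)) (fun i => x (Sum.inr i))
  | _, _, bang D => Matrix.of fun y x =>
      ∏ s, interp (D s) (fun j => y ⟨s, j⟩) (fun i => x ⟨s, i⟩)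

/-- Equality of diagrams when scalar factors are ignored: the matrices agree up to a nonzero
scalar. -/
def EqUpToScalar {ι κ : Type} (D E : ZHDiagram ι κ) : Prop :=
  ∃ c : ℂ, c ≠ 0 ∧ interp D = c • interp E

/-- The scalar `a`, drawn as an H-box without legs, next to the diagram `D`. -/
noncomputable def scale {ι κ : Type} [Fintype ι] [Fintype κ] (a : ℂ) (D : ZHDiagram ι κ) :
    ZHDiagram ι κ :=
  comp (wires (Equiv.emptySum Empty ι).symm)
    (comp (beside (hBox Empty Empty a) D) (wires (Equiv.emptySum Empty κ)))

/-- One single-wire diagram on each of the wires labelled by `ι`. -/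
def onWires {ι : Type} [Fintype ι] (D : ι → ZHDiagram Unit Unit) : ZHDiagram ι ι :=
  comp (wires ⟨fun i => ⟨i, ()⟩, fun p => p.1, fun _ => rfl, fun _ => rfl⟩)
    (comp (bang D) (wires ⟨fun p => p.1, fun i => ⟨i, ()⟩, fun _ => rfl, fun _ => rfl⟩))

/-- The unlabelled H-box with one input and one output: an unnormalised Hadamard gate. -/
noncomputable def hadamard : ZHDiagram Unit Unit := hBox Unit Unit (-1)

/-- The grey spider: a white spider with a Hadamard gate on every leg, normalised by `1/2`. -/
noncomputable def xSpider (ι κ : Type) [Fintype ι] [Fintype κ] : ZHDiagram ι κ :=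
  scale (1 / 2) (comp (onWires fun _ => hadamard)
    (comp (zSpider ι κ) (onWires fun _ => hadamard)))

/-- The NOT gate: conjugating by Hadamard gates the white spider to which an unlabelled one-legged
H-box is attached, normalised by `1/2`. -/
noncomputable def notGate : ZHDiagram Unit Unit :=
  scale (1 / 2) (comp hadamard
    (comp (comp (wires (Equiv.emptySum Empty Unit).symm)
      (comp (beside (hBox Empty Unit (-1)) (wires (Equiv.refl Unit))) (zSpider (Unit ⊕ Unit) Unit)))
      hadamard))

/-- The exponentiated H-box with label `α`, that is, the H-box labelled `e^{iα}`. -/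
noncomputable def expHBox (ι κ : Type) [Fintype ι] [Fintype κ] (α : ℂ) : ZHDiagram ι κ :=
  hBox ι κ (Complex.exp (Complex.I * α))

/-- The phase gadget with label `α` and `n` legs: a grey spider with `n` legs and a further one
which ends in a one-legged exponentiated H-box. -/
noncomputable def phaseGadget (n : ℕ) (α : ℂ) : ZHDiagram Empty (Fin n) :=
  comp (expHBox Empty Unit α) (xSpider Unit (Fin n))

/-- The indexing box of a bit string `b`: a NOT gate on wire `i` if `b i = 0`, and a plain wire if
`b i = 1`. -/
noncomputable def indexingBox {n : ℕ} (b : Fin n → Bool) : ZHDiagram (Fin n) (Fin n) :=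
  onWires fun i => if b i then wires (Equiv.refl Unit) else notGate

/-- The piece that separates a grey node (below) from a white node (above): the leg of the grey node
is closed by a one-legged grey spider and that of the white node by a one-legged white spider. -/
noncomputable def disconnectPiece : ZHDiagram Unit Unit :=
  comp (xSpider Unit Empty) (zSpider Empty Unit)

/-- The grey disconnect box of a bit string `c`: wire `i` is cut if `c i = 0`, and is a plain wire
if `c i = 1`. -/
noncomputable def disconnectBox {n : ℕ} (c : Fin n → Bool) : ZHDiagram (Fin n) (Fin n) :=
  onWires fun i => if c i then wires (Equiv.refl Unit) else disconnectPiece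

/-- For every bit string `b` a diagram `D b` with `n` outputs, the `i`-th of which is connected to
the `i`-th of `n` white spiders; each of these spiders has one further leg, which is an output. -/
def onWhiteSpiders {n : ℕ} (D : (Fin n → Bool) → ZHDiagram Empty (Fin n)) :
    ZHDiagram Empty (Fin n) :=
  comp (wires (κ := (_ : Fin n → Bool) × Empty)
      ⟨fun e => e.elim, fun p => p.2, fun e => e.elim, fun p => p.2.elim⟩)
    (comp (bang D)
      (comp (wires (κ := (_ : Fin n) × (Fin n → Bool))
          ⟨fun p => ⟨p.2, p.1⟩, fun p => ⟨p.2, p.1⟩, fun _ => rfl, fun _ => rfl⟩)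
        (comp (bang fun _ : Fin n => zSpider (Fin n → Bool) Unit)
          (wires ⟨fun p => p.1, fun i => ⟨i, ()⟩, fun _ => rfl, fun _ => rfl⟩))))

/-- The ZH normal form of the vector `∑ b, a b |b⟩`. -/
noncomputable def normalForm {n : ℕ} (a : (Fin n → Bool) → ℂ) : ZHDiagram Empty (Fin n) :=
  onWhiteSpiders fun b => comp (hBox Empty (Fin n) (a b)) (indexingBox b)

/-- The normal form made of exponentiated H-boxes with labels `α b`: the left-hand side of the
graphical Fourier transform. -/
noncomputable def expNormalForm {n : ℕ} (α : (Fin n → Bool) → ℂ) : ZHDiagram Empty (Fin n) :=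
  onWhiteSpiders fun b => comp (expHBox Empty (Fin n) (α b)) (indexingBox b)

/-- The diagram made of phase gadgets with labels `β c`, each connected through the grey disconnect
box of `c`: the right-hand side of the graphical Fourier transform. -/
noncomputable def fourierDiagram {n : ℕ} (β : (Fin n → Bool) → ℂ) : ZHDiagram Empty (Fin n) :=
  onWhiteSpiders fun c => comp (phaseGadget n (β c)) (disconnectBox c)

end ZHDiagram

/-- The parity function `χ(b, c) = (-1)^{b·c}`. -/
def parityChar {n : ℕ} (b c : Fin n → Bool) : ℂ := (-1) ^ (∑ i, (b i && c i).toNat)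

/-- The Fourier coefficients `α̃_c = -1 / 2^{n-1} ∑ b, α_b χ(b, c)`. -/
noncomputable def zhFourierCoeff {n : ℕ} (α : (Fin n → Bool) → ℂ) (c : Fin n → Bool) : ℂ :=
  -1 / (2 : ℂ) ^ ((n : ℤ) - 1) * ∑ b, α b * parityChar b c

/-- The exponents `α_b = -i ln a_b` if `a_b ≠ 0`, and `α_b = -i ln ε` if `a_b = 0`. -/
noncomputable def approxExponent {n : ℕ} (a : (Fin n → Bool) → ℂ) (ε : ℝ) (b : Fin n → Bool) : ℂ :=
  if a b = 0 then -Complex.I * Complex.log (ε : ℂ) else -Complex.I * Complex.log (a b)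

/-! White spiders copy each output bit to every box of the family, so both kinds of diagram are
entrywise products of their pieces (`interp_onWhiteSpiders`). In a normal form, the box of `b`
contributes its label at `y = b` and `1` elsewhere, so the `y` entry is `a y`. Since `exp` inverts
`log` on nonzero numbers, the chosen exponents reproduce `a` with zeros replaced by `ε`. A phase
gadget contributes `e^{iβ_c}` when `y·c` is odd and `1` otherwise, that is `exp (iβ_c (1 -
χ(y,c))/2)`. Fourier inversion (`sum_zhFourierCoeff`) turns the total exponent into `α y - α 0`, and
the constant `α 0` is the ignored scalar. -/

namespace ZHDiagram

/-- The sign `(-1)^b` of a bit. -/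
def bitSign (b : Bool) : ℂ := if b then -1 else 1

@[simp] lemma bitSign_true : bitSign true = -1 := rfl

@[simp] lemma bitSign_false : bitSign false = 1 := rfl

/-! ### Matrix entries of the generators and of the ways to combine them. -/

lemma sum_unit_bool (f : (Unit → Bool) → ℂ) :
    ∑ x, f x = f (fun _ => false) + f (fun _ => true) := by
  rw [← (Equiv.funUnique Unit Bool).symm.sum_comp f, Fintype.sum_bool, add_comm]
  rfl

lemma interp_comp_apply {ι κ μ : Type} [Fintype κ] [DecidableEq κ] (D : ZHDiagram ι κ) (E : ZHDiagram κ μ)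
    (y : μ → Bool) (x : ι → Bool) :
    (comp D E).interp y x = ∑ w : κ → Bool, E.interp y w * D.interp w x := by
  simp only [interp, Matrix.mul_apply]
  -- `interp` sums with a classical `Fintype` instance; the two versions of `univ` must be
  -- identified.
  exact Finset.sum_congr (by ext; simp) fun _ _ => rfl

/-- Nested conditions on equality of functions let `Finset.sum_ite_eq'` collapse sums over the
input. -/
lemma interp_zSpider_apply {ι κ : Type} [Fintype ι] [Fintype κ] (y : κ → Bool) (x : ι → Bool) :
    (zSpider ι κ).interp y x =
      (if x = (fun _ => false) then if y = (fun _ => false) then 1 else 0 else 0) +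
      (if x = (fun _ => true) then if y = (fun _ => true) then 1 else 0 else 0) := by
  simp only [interp, Matrix.of_apply, funext_iff, ite_and]

lemma interp_hBox_apply {ι κ : Type} [Fintype ι] [Fintype κ] (a : ℂ) (y : κ → Bool)
    (x : ι → Bool) :
    (hBox ι κ a).interp y x = if (∀ i, x i = true) ∧ (∀ j, y j = true) then a else 1 := by
  simp only [interp, Matrix.of_apply]

lemma interp_beside_apply {ι κ ι' κ' : Type} (D : ZHDiagram ι κ) (E : ZHDiagram ι' κ')
    (y : κ ⊕ κ' → Bool) (x : ι ⊕ ι' → Bool) :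
    (beside D E).interp y x =
      D.interp (fun j => y (Sum.inl j)) (fun i => x (Sum.inl i)) *
        E.interp (fun j => y (Sum.inr j)) (fun i => x (Sum.inr i)) := by
  simp only [interp, Matrix.of_apply]

lemma interp_bang_apply {S : Type} [Fintype S] {ι κ : S → Type}
    (D : (s : S) → ZHDiagram (ι s) (κ s)) (y : ((s : S) × κ s) → Bool)
    (x : ((s : S) × ι s) → Bool) :
    (bang D).interp y x = ∏ s, (D s).interp (fun j => y ⟨s, j⟩) (fun i => x ⟨s, i⟩) := by
  simp only [interp, Matrix.of_apply]

lemma interp_wires_apply {ι κ : Type} (e : ι ≃ κ) (y : κ → Bool) (x : ι → Bool)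
    [Decidable ((fun i => y (e i)) = x)] :
    (wires e).interp y x = if (fun i => y (e i)) = x then 1 else 0 := by
  classical
  simp only [interp, Matrix.of_apply]
  exact if_congr funext_iff.symm rfl rfl

lemma interp_comp_wires {ι κ μ : Type} [Fintype κ] (D : ZHDiagram ι κ) (e : κ ≃ μ)
    (y : μ → Bool) (x : ι → Bool) :
    (comp D (wires e)).interp y x = D.interp (fun i => y (e i)) x := by
  classical
  simp [interp_comp_apply, interp_wires_apply]

lemma interp_wires_comp {ι κ μ : Type} [Fintype κ] (e : ι ≃ κ) (D : ZHDiagram κ μ)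
    (y : μ → Bool) (x : ι → Bool) :
    (comp (wires e) D).interp y x = D.interp y (fun j => x (e.symm j)) := by
  classical
  have h : ∀ w : κ → Bool, ((fun i => w (e i)) = x) ↔ w = fun j => x (e.symm j) := fun w =>
    ⟨fun h => by subst h; simp, fun h => by subst h; simp⟩
  simp [interp_comp_apply, interp_wires_apply, h]

lemma interp_scale {ι κ : Type} [Fintype ι] [Fintype κ] (a : ℂ) (D : ZHDiagram ι κ)
    (y : κ → Bool) (x : ι → Bool) : (scale a D).interp y x = a * D.interp y x := by
  simp only [scale, interp_wires_comp, interp_comp_wires, interp_beside_apply, interp_hBox_apply]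
  simp

lemma interp_onWires {ι : Type} [Fintype ι] (D : ι → ZHDiagram Unit Unit) (y x : ι → Bool) :
    (onWires D).interp y x = ∏ i, (D i).interp (fun _ => y i) (fun _ => x i) := by
  simp only [onWires, interp_wires_comp, interp_comp_wires, interp_bang_apply]
  rfl

lemma interp_onWhiteSpiders {n : ℕ} (D : (Fin n → Bool) → ZHDiagram Empty (Fin n))
    (y : Fin n → Bool) (x : Empty → Bool) :
    (onWhiteSpiders D).interp y x = ∏ b, (D b).interp y x := by
  -- The spiders force the intermediate bit on wire `(b, i)` to be `y i`, so only one term of the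
  -- sum over `w` survives.
  have key (w : ((_ : Fin n → Bool) × Fin n) → Bool) :
      (∏ i, (zSpider (Fin n → Bool) Unit).interp (fun _ => y i) (fun b => w ⟨b, i⟩)) =
        if w = (fun p => y p.2) then 1 else 0 := by
    have h (i : Fin n) :
        (zSpider (Fin n → Bool) Unit).interp (fun _ => y i) (fun b => w ⟨b, i⟩) =
          if ∀ b, w ⟨b, i⟩ = y i then 1 else 0 := by
      rw [interp_zSpider_apply]
      cases y i <;> simp [funext_iff]
    simp only [h, Fintype.prod_ite_zero, Finset.prod_const_one]
    refine if_congr ?_ rfl rfl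
    simp only [funext_iff, Sigma.forall]
    exact forall_comm
  simp only [onWhiteSpiders, interp_wires_comp]
  rw [interp_comp_apply]
  simp only [interp_wires_comp, interp_comp_wires, interp_bang_apply]
  refine (Finset.sum_congr rfl fun w _ => congrArg (· * _) (key w)).trans ?_
  simp only [ite_mul, one_mul, zero_mul, Finset.sum_ite_eq', Finset.mem_univ, if_true]
  exact Finset.prod_congr rfl fun b _ => congrArg ((D b).interp y) (Subsingleton.elim _ _)

/-! ### Gates, grey spiders and the boxes built from them. -/

lemma interp_hadamard (y x : Unit → Bool) :
    hadamard.interp y x = if x () then bitSign (y ()) else 1 := by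
  rw [hadamard, interp_hBox_apply]
  cases hx : x () <;> cases hy : y () <;> simp [hx, hy]

/-- The inner diagram is `Z = diag(1, -1)`, and with unnormalised Hadamards `HZH = 2X`; the factor
`1/2` cancels the `2`. -/
lemma interp_notGate (y x : Bool) :
    notGate.interp (fun _ => y) (fun _ => x) = if y = !x then 1 else 0 := by
  simp only [notGate, interp_scale, interp_comp_apply hadamard, interp_comp_apply _ hadamard,
    interp_wires_comp, interp_comp_apply _ (zSpider _ _), interp_beside_apply,
    interp_wires_apply, interp_hBox_apply, interp_zSpider_apply, sum_unit_bool, interp_hadamard]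
  simp only [ite_mul, add_mul, zero_mul, Finset.sum_add_distrib, Finset.sum_ite_eq',
    Finset.mem_univ, if_true]
  cases x <;> cases y <;> simp [funext_iff] <;> norm_num

/-- The all-zeros term of the white spider gives `1`, the all-ones term the product of the signs of
all legs. -/
lemma interp_xSpider {ι κ : Type} [Fintype ι] [Fintype κ] (y : κ → Bool) (x : ι → Bool) :
    (xSpider ι κ).interp y x = (1 + (∏ j, bitSign (y j)) * ∏ i, bitSign (x i)) / 2 := by
  classical
  have h (b : Bool) : (if b then (-1 : ℂ) else 1) = bitSign b := rfl
  simp only [xSpider, interp_scale, interp_comp_apply (onWires _), interp_comp_apply (zSpider _ _),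
    interp_zSpider_apply, interp_onWires, interp_hadamard]
  simp only [mul_add, add_mul, mul_ite, ite_mul, mul_zero, zero_mul, mul_one,
    Finset.sum_add_distrib, Finset.sum_ite_eq', Finset.mem_univ, if_true, Finset.sum_ite_irrel,
    Finset.sum_const_zero]
  simp [h, div_eq_inv_mul, mul_add]

lemma interp_disconnectPiece (y x : Bool) :
    disconnectPiece.interp (fun _ => y) (fun _ => x) = if x = false then 1 else 0 := by
  simp only [disconnectPiece, interp_comp_apply, interp_xSpider, interp_zSpider_apply]
  cases x <;> cases y <;> simp [funext_iff]

/-- The H-box below sees all ones exactly when `y = b`. -/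
lemma interp_indexingBox {n : ℕ} (b y x : Fin n → Bool) :
    (indexingBox b).interp y x = if x = (fun i => y i == b i) then 1 else 0 := by
  have h (i : Fin n) :
      (if b i then wires (Equiv.refl Unit) else notGate).interp (fun _ => y i) (fun _ => x i) =
        if x i = (y i == b i) then 1 else 0 := by
    cases b i
    · rw [if_neg (by simp), interp_notGate]
      cases x i <;> cases y i <;> simp
    · rw [if_pos rfl, interp_wires_apply]
      cases x i <;> cases y i <;> simp [funext_iff]
  simp only [indexingBox, interp_onWires, h, Fintype.prod_ite_zero, Finset.prod_const_one,
    funext_iff]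

lemma interp_disconnectBox {n : ℕ} (c y x : Fin n → Bool) :
    (disconnectBox c).interp y x = if x = (fun i => y i && c i) then 1 else 0 := by
  have h (i : Fin n) :
      (if c i then wires (Equiv.refl Unit) else disconnectPiece).interp
        (fun _ => y i) (fun _ => x i) = if x i = (y i && c i) then 1 else 0 := by
    cases c i
    · rw [if_neg (by simp), interp_disconnectPiece]
      cases x i <;> cases y i <;> simp
    · rw [if_pos rfl, interp_wires_apply]
      cases x i <;> cases y i <;> simp [funext_iff]
  simp only [disconnectBox, interp_onWires, h, Fintype.prod_ite_zero, Finset.prod_const_one,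
    funext_iff]

/-! ### Matrices of normal forms and of diagrams of phase gadgets. -/

lemma interp_normalForm {n : ℕ} (a : (Fin n → Bool) → ℂ) (y : Fin n → Bool) (x : Empty → Bool) :
    (normalForm a).interp y x = a y := by
  have h (b : Fin n → Bool) :
      (comp (hBox Empty (Fin n) (a b)) (indexingBox b)).interp y x = if y = b then a b else 1 := by
    simp only [interp_comp_apply, interp_indexingBox, interp_hBox_apply, ite_mul, one_mul, zero_mul,
      Finset.sum_ite_eq', Finset.mem_univ, if_true]
    simp [funext_iff]
  simp [normalForm, interp_onWhiteSpiders, h]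

lemma expNormalForm_eq_normalForm {n : ℕ} (α : (Fin n → Bool) → ℂ) :
    expNormalForm α = normalForm fun b => Complex.exp (Complex.I * α b) := rfl

lemma prod_bitSign_and {n : ℕ} (b c : Fin n → Bool) :
    ∏ i, bitSign (b i && c i) = parityChar b c := by
  rw [parityChar, ← Finset.prod_pow_eq_pow_sum]
  refine Finset.prod_congr rfl fun i _ => ?_
  cases b i <;> cases c i <;> simp

lemma parityChar_eq_one_or {n : ℕ} (b c : Fin n → Bool) :
    parityChar b c = 1 ∨ parityChar b c = -1 :=
  neg_one_pow_eq_or ℂ _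

/-- `(1 - χ)/2` is the parity of `y·c` as a number `0` or `1`; in the exponent it makes the product
over `c` a sum that is linear in `β`. -/
lemma interp_phaseGadget_disconnectBox {n : ℕ} (β : ℂ) (c y : Fin n → Bool) (x : Empty → Bool) :
    (comp (phaseGadget n β) (disconnectBox c)).interp y x =
      Complex.exp (Complex.I * (β * ((1 - parityChar y c) / 2))) := by
  rw [interp_comp_apply]
  simp only [interp_disconnectBox, ite_mul, one_mul, zero_mul, Finset.sum_ite_eq',
    Finset.mem_univ, if_true, phaseGadget, expHBox]
  rw [interp_comp_apply, sum_unit_bool]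
  simp only [interp_xSpider, interp_hBox_apply, prod_bitSign_and]
  rcases parityChar_eq_one_or y c with h | h <;> simp [h]

lemma interp_fourierDiagram {n : ℕ} (β : (Fin n → Bool) → ℂ) (y : Fin n → Bool)
    (x : Empty → Bool) :
    (fourierDiagram β).interp y x =
      Complex.exp (Complex.I * ∑ c, β c * ((1 - parityChar y c) / 2)) := by
  simp only [fourierDiagram, interp_onWhiteSpiders, interp_phaseGadget_disconnectBox]
  rw [← Complex.exp_sum, Finset.mul_sum]

/-! ### Fourier inversion. -/

/-- Orthogonality of the parity functions. -/
lemma sum_parityChar_mul {n : ℕ} (b y : Fin n → Bool) :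
    ∑ c, parityChar b c * parityChar y c = if b = y then 2 ^ n else 0 := by
  have h (i : Fin n) : ∑ t : Bool, bitSign (b i && t) * bitSign (y i && t) =
      if b i = y i then 2 else 0 := by
    cases b i <;> cases y i <;> norm_num
  simp only [← prod_bitSign_and, ← Finset.prod_mul_distrib]
  -- The sum over bit strings factorises into one sum per bit, each `2` or `0`.
  rw [← Fintype.prod_sum (fun i t => bitSign (b i && t) * bitSign (y i && t))]
  simp only [h, Fintype.prod_ite_zero, funext_iff]
  simp

lemma parityChar_zero_left {n : ℕ} (c : Fin n → Bool) : parityChar (fun _ => false) c = 1 := by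
  simp [parityChar]

/-- The Fourier inversion formula behind the graphical Fourier transform. -/
lemma sum_zhFourierCoeff {n : ℕ} (α : (Fin n → Bool) → ℂ) (y : Fin n → Bool) :
    ∑ c, zhFourierCoeff α c * ((1 - parityChar y c) / 2) = α y - α (fun _ => false) := by
  have hz (z : Fin n → Bool) :
      ∑ c, (∑ b, α b * parityChar b c) * parityChar z c = 2 ^ n * α z := by
    simp only [Finset.sum_mul]
    rw [Finset.sum_comm]
    simp only [mul_assoc, ← Finset.mul_sum, sum_parityChar_mul]
    simp [mul_comm]
  have h2 : (2 : ℂ) ^ n ≠ 0 := pow_ne_zero n two_ne_zero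
  -- The constant `1` is the character of the zero string, so inversion applies at `y` and at `0`.
  -- The prefactor becomes `-1 / 2^n`, whose sign swaps the two terms.
  calc ∑ c, zhFourierCoeff α c * ((1 - parityChar y c) / 2)
      = ∑ c, (1 / 2 ^ n) * ((∑ b, α b * parityChar b c) * parityChar y c -
          (∑ b, α b * parityChar b c) * parityChar (fun _ => false) c) := by
        refine Finset.sum_congr rfl fun c _ => ?_
        -- The exponent `n - 1` is an integer, so `n = 0` needs no separate case.
        rw [zhFourierCoeff, zpow_sub₀ two_ne_zero, zpow_natCast, zpow_one, parityChar_zero_left]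
        field_simp
        ring
    _ = α y - α (fun _ => false) := by
        rw [← Finset.mul_sum, Finset.sum_sub_distrib, hz, hz]
        field_simp

/-- The graphical Fourier transform. -/
theorem expNormalForm_eqUpToScalar_fourierDiagram {n : ℕ} (α : (Fin n → Bool) → ℂ) :
    EqUpToScalar (expNormalForm α) (fourierDiagram (zhFourierCoeff α)) := by
  -- The scalar is the all-zeros entry of the normal form: every phase gadget contributes `1` there.
  refine ⟨Complex.exp (Complex.I * α (fun _ => false)), Complex.exp_ne_zero _, ?_⟩
  ext y x
  rw [Matrix.smul_apply, smul_eq_mul, expNormalForm_eq_normalForm, interp_normalForm,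
    interp_fourierDiagram, sum_zhFourierCoeff, ← Complex.exp_add]
  congr 1
  ring

end ZHDiagram

/-- Only `exp (log z) = z` for `z ≠ 0` matters, so the branch of the logarithm plays no role. -/
lemma exp_I_mul_approxExponent {n : ℕ} (a : (Fin n → Bool) → ℂ) {ε : ℝ} (hε : 0 < ε)
    (b : Fin n → Bool) :
    Complex.exp (Complex.I * approxExponent a ε b) = if a b = 0 then (ε : ℂ) else a b := by
  have h (z : ℂ) : Complex.I * (-Complex.I * z) = z := by
    rw [← mul_assoc, mul_neg, Complex.I_mul_I, neg_neg, one_mul]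
  unfold approxExponent
  split_ifs with hb
  · rw [h, Complex.exp_log (Complex.ofReal_ne_zero.mpr hε.ne')]
  · rw [h, Complex.exp_log hb]

theorem mainTheorem4 (n : ℕ) (a : (Fin n → Bool) → ℂ) (ε : ℝ) (hε : 0 < ε) :
    -- the exponentiated normal form is the normal form in which each zero entry is replaced by `ε`
    ZHDiagram.expNormalForm (approxExponent a ε) =
      ZHDiagram.normalForm (fun b => if a b = 0 then (ε : ℂ) else a b) ∧
    -- it approximates the given normal form up to `ε`
    (∀ (y : Fin n → Bool) (x : Empty → Bool),
      ‖(ZHDiagram.normalForm a).interp y x -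
        (ZHDiagram.expNormalForm (approxExponent a ε)).interp y x‖ ≤ ε) ∧
    -- its graphical Fourier transform is the diagram of phase gadgets
    ZHDiagram.EqUpToScalar (ZHDiagram.expNormalForm (approxExponent a ε))
      (ZHDiagram.fourierDiagram (zhFourierCoeff (approxExponent a ε))) := by
  have h1 : ZHDiagram.expNormalForm (approxExponent a ε) =
      ZHDiagram.normalForm (fun b => if a b = 0 then (ε : ℂ) else a b) := by
    rw [ZHDiagram.expNormalForm_eq_normalForm]
    exact congrArg _ (funext (exp_I_mul_approxExponent a hε))
  refine ⟨h1, fun y x => ?_, ZHDiagram.expNormalForm_eqUpToScalar_fourierDiagram _⟩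
  rw [h1, ZHDiagram.interp_normalForm, ZHDiagram.interp_normalForm]
  -- At a zero of `a` the error is exactly `ε`; elsewhere it vanishes.
  split_ifs with hy
  · simp [hy, abs_of_pos hε]
  · simpa using hε.le
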